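/- Let $n\ge 1$ and let $\rho_1,\dots,\rho_n$ be arbitrary two-qubit states (density matrices on $\mathbb{C}^2\otimes\mathbb{C}^2$), $\rho_i$ being distributed by the $i$-th of the $n$ independent sources of an $n$-local star network. For each $i$ let $E_{i1}\ge E_{i2}\ge E_{i3}\ge 0$ be the singular values of the real $3\times 3$ correlation tensor $R^{(i)}_{kl}=\operatorname{Tr}[\rho_i\,(\sigma_k\otimes\sigma_l)]$, where $\sigma_1,\sigma_2,\sigma_3$ are the Pauli matrices, and let $$\mathcal{C}_i=\max\bigl\{0,\ \sqrt{\mu_{i1}}-\sqrt{\mu_{i2}}-\sqrt{\mu_{i3}}-\sqrt{\mu_{i4}}\bigr\}$$ be the (Wootters) concurrence of $\rho_i$, where $\mu_{i1}\ge\mu_{i2}\ge\mu_{i3}\ge\mu_{i4}\ge 0$ are the eigenvalues, with multiplicity, of $\rho_i(\sigma_2\otimes\sigma_2)\rho_i^{T}(\sigma_2\otimes\sigma_2)$. Define $$B_{n\text{-star}}=\sqrt{\Bigl(\prod_{j=1}^n E_{j1}\Bigr)^{2/n}+\Bigl(\prod_{j=1}^n E_{j2}\Bigr)^{2/n}}.$$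 Then $$B_{n\text{-star}}\le\sqrt{1+\frac1n\sum_{i=1}^n\mathcal{C}_i^2}.$$ -/

import Mathlib

open scoped Kronecker ComplexOrder

noncomputable section

namespace StarNetwork

/-- The Pauli matrices `σ₁, σ₂, σ₃`, indexed by `0, 1, 2`. -/
def pauli : Fin 3 → Matrix (Fin 2) (Fin 2) ℂ :=
  ![!![0, 1; 1, 0], !![0, -Complex.I; Complex.I, 0], !![1, 0; 0, -1]]

/-- Two-qubit states: density matrices on `ℂ² ⊗ ℂ²`, in the product basis. -/
structure TwoQubitState where
  mat : Matrix (Fin 2 × Fin 2) (Fin 2 × Fin 2) ℂ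
  posSemidef : mat.PosSemidef
  trace_eq_one : mat.trace = 1

namespace TwoQubitState

/-- The correlation tensor `r i j = Tr[ρ (σ i ⊗ σ j)]`. The trace is real, as `ρ` and `σ i ⊗ σ j`
are Hermitian. -/
def correlationTensor (ρ : TwoQubitState) : Matrix (Fin 3) (Fin 3) ℝ :=
  Matrix.of fun i j => (ρ.mat * (pauli i ⊗ₖ pauli j)).trace.re

/-- `ρ.E 0 ≥ ρ.E 1 ≥ ρ.E 2` are the singular values of the correlation tensor `R`, that is, the
eigenvalues of `√(Rᵀ R)` with multiplicity, in decreasing order. -/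
def E (ρ : TwoQubitState) (k : ℕ) : ℝ :=
  (Matrix.toEuclideanLin ρ.correlationTensor).singularValues k

/-- The matrix `ρ (σ₂ ⊗ σ₂) ρᵀ (σ₂ ⊗ σ₂)`. -/
def spinFlipProduct (ρ : TwoQubitState) : Matrix (Fin 2 × Fin 2) (Fin 2 × Fin 2) ℂ :=
  ρ.mat * (pauli 1 ⊗ₖ pauli 1) * ρ.mat.transpose * (pauli 1 ⊗ₖ pauli 1)

/-- `ρ.μ 0 ≥ ρ.μ 1 ≥ ρ.μ 2 ≥ ρ.μ 3` are the eigenvalues (with algebraic multiplicity, in decreasing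
order) of `ρ (σ₂ ⊗ σ₂) ρᵀ (σ₂ ⊗ σ₂)`. They are real and nonnegative, this matrix being a product of
two positive semidefinite ones. -/
def μ (ρ : TwoQubitState) (k : ℕ) : ℝ :=
  ((ρ.spinFlipProduct.charpoly.roots.map Complex.re).sort (· ≥ ·)).getD k 0

/-- The (Wootters) concurrence. -/
def concurrence (ρ : TwoQubitState) : ℝ :=
  max 0 (√(ρ.μ 0) - √(ρ.μ 1) - √(ρ.μ 2) - √(ρ.μ 3))

end TwoQubitState

/-- The quantity `B` of an `n`-local star network whose `j`-th source distributes `ρ j`. -/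
def starB {n : ℕ} (ρ : Fin n → TwoQubitState) : ℝ :=
  √((∏ j, (ρ j).E 0) ^ ((2 : ℝ) / n) + (∏ j, (ρ j).E 1) ^ ((2 : ℝ) / n))

end StarNetwork

end

/-! The AM–GM inequality (`prod_rpow_two_div_le`) reduces everything to one state, for which
`E_zero_sq_add_E_one_sq_le` gives `E₀² + E₁² ≤ 1 + C²`.

In the magic basis each `σ_k ⊗ σ_l` is a real symmetric matrix, so correlations depend only on the
real part `M` of the density matrix (`magicRe`). The central fact is that `0 ≤ M ≤ (1 + C) / 2` as a
quadratic form (`dotProduct_magicRe_mulVec_mem`). Writing `ρ = A A*` in this basis, the numbers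
`√μ_k` are the singular values of `Aᵀ A`. For a real unit vector `v` and `x = Aᵀ v`, one has `Aᵀ A =
x xᵀ + ∑ zᵢ zᵢᵀ` with `∑ ‖zᵢ‖² = 1 - ‖x‖²`. Pairing this with a contraction that reverses the sign
of the `x xᵀ` term and has trace of real part at least `dim - 2` yields `2 ‖x‖² ≤ 1 + C`.

For orthonormal pairs `a, a'` and `b, b'`, the involutions `a·σ ⊗ b·σ` and `a'·σ ⊗ b'·σ` commute,
and their joint eigenprojections have rank one and are real. Bounding these four expectations gives
`|x| + |z| ≤ 1 + C` and `|x|, |z| ≤ 1` for the two correlations, hence `x² + z² ≤ 1 + C²`. Singular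
vectors of `R` then give the claim. -/

open scoped Kronecker ComplexOrder InnerProductSpace

noncomputable section

namespace StarNetwork

/-! ### Sums of rank-one operators and singular values. -/

section RankOne

variable {E : Type*} [NormedAddCommGroup E] [InnerProductSpace ℂ E]

/-- A linear map acting on the span of the vectors `y` and `e`, and trivially on its orthogonal
complement. For orthonormal `y` and `e` and `‖α‖² + ‖β‖² = 1`, it is unitary. -/
def planeMap (y e : E) (α β : ℂ) : E →ₗ[ℂ] E where
  toFun z := z - ((1 + α) * ⟪y, z⟫_ℂ + star β * ⟪e, z⟫_ℂ) • y
    - (β * ⟪y, z⟫_ℂ + (1 - star α) * ⟪e, z⟫_ℂ) • e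
  map_add' z w := by
    simp only [inner_add_right]
    module
  map_smul' c z := by
    simp only [inner_smul_right, RingHom.id_apply]
    module

theorem planeMap_apply (y e : E) (α β : ℂ) (z : E) :
    planeMap y e α β z = z - ((1 + α) * ⟪y, z⟫_ℂ + star β * ⟪e, z⟫_ℂ) • y
      - (β * ⟪y, z⟫_ℂ + (1 - star α) * ⟪e, z⟫_ℂ) • e := rfl

/-- On the span of `y, e` the map sends `y` to `-(α y + β e)` and `e` to `-β̄ y + ᾱ e`, a unitary
matrix. The alternative `e = 0` covers the case where the target is a multiple of `y`, possibly with
no second dimension available. -/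
theorem norm_planeMap {y e : E} {α β : ℂ} (hy : ⟪y, y⟫_ℂ = 1) (hye : ⟪y, e⟫_ℂ = 0)
    (he : ⟪e, e⟫_ℂ = 1 ∨ e = 0 ∧ β = 0) (hαβ : α * star α + β * star β = 1) (z : E) :
    ‖planeMap y e α β z‖ = ‖z‖ := by
  have hey : ⟪e, y⟫_ℂ = 0 := inner_eq_zero_symm.mp hye
  have key : ⟪planeMap y e α β z, planeMap y e α β z⟫_ℂ = ⟪z, z⟫_ℂ := by
    rw [planeMap_apply]
    have h1 : ⟪z, y⟫_ℂ = star ⟪y, z⟫_ℂ := (inner_conj_symm z y).symm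
    have h2 : ⟪z, e⟫_ℂ = star ⟪e, z⟫_ℂ := (inner_conj_symm z e).symm
    simp only [inner_sub_left, inner_sub_right, inner_smul_left, inner_smul_right, h1, h2, hy, hye,
      hey]
    rcases he with he | ⟨rfl, rfl⟩
    · simp only [he, ← Complex.star_def, star_add, star_mul', star_star, star_sub, star_one]
      linear_combination (⟪y, z⟫_ℂ * star ⟪y, z⟫_ℂ + ⟪e, z⟫_ℂ * star ⟪e, z⟫_ℂ) * hαβ
    · simp only [← Complex.star_def, star_add, star_mul', star_one,
        star_zero, inner_zero_left, inner_zero_right, mul_zero, zero_mul, add_zero, sub_zero] at *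
      linear_combination (⟪y, z⟫_ℂ * star ⟪y, z⟫_ℂ) * hαβ
  have := congrArg Complex.re key
  rw [← RCLike.re_eq_complex_re, inner_self_eq_norm_sq, inner_self_eq_norm_sq] at this
  exact (sq_eq_sq₀ (norm_nonneg _) (norm_nonneg _)).mp this

/-- For vectors `y` and `q` of the same norm, some contraction maps `y` to `-q` and has a trace of
real part at least `dim E - 2`. -/
theorem exists_contraction_map_eq_neg {κ : Type*} [Fintype κ] (u : OrthonormalBasis κ ℂ E)
    {y q : E} (hyq : ‖y‖ = ‖q‖) :
    ∃ V : E →ₗ[ℂ] E, (∀ z, ‖V z‖ ≤ ‖z‖) ∧ V y = -q ∧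
      (Fintype.card κ : ℝ) - 2 ≤ (∑ k, ⟪u k, V (u k)⟫_ℂ).re := by
  rcases eq_or_ne y 0 with rfl | hy0
  · refine ⟨LinearMap.id, fun z => le_rfl, ?_, ?_⟩
    · have : q = 0 := by simpa using hyq.symm
      simp [this]
    · simp
  have hn : (‖y‖ : ℂ) ≠ 0 := by simpa using hy0
  obtain ⟨y', hy'⟩ : ∃ y' : E, y' = ((‖y‖ : ℂ)⁻¹) • y := ⟨_, rfl⟩
  obtain ⟨q', hq'⟩ : ∃ q' : E, q' = ((‖y‖ : ℂ)⁻¹) • q := ⟨_, rfl⟩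
  have hy1 : ⟪y', y'⟫_ℂ = 1 := by
    rw [inner_self_eq_norm_sq_to_K, hy', norm_smul]
    simp [hy0]
  have hq1 : ⟪q', q'⟫_ℂ = 1 := by
    have : ‖q‖ ≠ 0 := by rw [← hyq]; simpa using hy0
    rw [inner_self_eq_norm_sq_to_K, hq', norm_smul, hyq]
    simp [this]
  obtain ⟨α, β, e, hq, hye, he, hαβ⟩ : ∃ (α β : ℂ) (e : E), q' = α • y' + β • e ∧
      ⟪y', e⟫_ℂ = 0 ∧ (⟪e, e⟫_ℂ = 1 ∨ e = 0 ∧ β = 0) ∧ α * star α + β * star β = 1 := by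
    set α := ⟪y', q'⟫_ℂ with hα
    have hα' : ⟪q', y'⟫_ℂ = star α := (inner_conj_symm q' y').symm
    have horth : ⟪y', q' - α • y'⟫_ℂ = 0 := by
      rw [inner_sub_right, inner_smul_right, hy1, ← hα]; ring
    have hself : ⟪q' - α • y', q' - α • y'⟫_ℂ = 1 - α * star α := by
      simp only [inner_sub_left, inner_sub_right, inner_smul_left, inner_smul_right, hy1, hq1,
        ← hα, hα', ← Complex.star_def]
      ring
    -- The vector `e` is the normalized component of `q'` orthogonal to `y'`, if there is one.
    by_cases h0 : q' - α • y' = 0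
    · refine ⟨α, 0, 0, ?_, by simp, Or.inr ⟨rfl, rfl⟩, ?_⟩
      · simpa [sub_eq_zero] using h0
      · rw [h0, inner_zero_left] at hself
        simp only [zero_mul]
        linear_combination hself
    · have hne : (‖q' - α • y'‖ : ℂ) ≠ 0 := by simpa using h0
      rw [inner_self_eq_norm_sq_to_K] at hself
      refine ⟨α, ‖q' - α • y'‖, ((‖q' - α • y'‖ : ℂ)⁻¹) • (q' - α • y'), ?_, ?_, Or.inl ?_, ?_⟩
      · rw [smul_smul, mul_inv_cancel₀ hne]; simp
      · rw [inner_smul_right, horth, mul_zero]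
      · rw [inner_self_eq_norm_sq_to_K, norm_smul]
        have : ‖q' - α • y'‖ ≠ 0 := by simpa using h0
        simp [this]
      · have : star (‖q' - α • y'‖ : ℂ) = ‖q' - α • y'‖ := Complex.conj_ofReal _
        rw [this]
        simp only [Complex.coe_algebraMap] at hself
        linear_combination hself
  have hey : ⟪e, y'⟫_ℂ = 0 := inner_eq_zero_symm.mp hye
  have hyy : y = (‖y‖ : ℂ) • y' := by rw [hy', smul_smul, mul_inv_cancel₀ hn, one_smul]
  have hqq : q = (‖y‖ : ℂ) • q' := by rw [hq', smul_smul, mul_inv_cancel₀ hn, one_smul]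
  refine ⟨planeMap y' e α β, fun z => (norm_planeMap hy1 hye he hαβ z).le, ?_, ?_⟩
  · have hV : planeMap y' e α β y' = -q' := by
      rw [hq, planeMap_apply, hy1, hey]
      module
    conv_lhs => rw [hyy, map_smul, hV]
    rw [smul_neg, ← hqq]
  · have h1 : ∀ a b : E, ∑ k, ⟪a, u k⟫_ℂ * ⟪u k, b⟫_ℂ = ⟪a, b⟫_ℂ := u.sum_inner_mul_inner
    have htr : ∑ k, ⟪u k, planeMap y' e α β (u k)⟫_ℂ
        = Fintype.card κ - (1 + α) - (1 - star α) * ⟪e, e⟫_ℂ := by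
      calc ∑ k, ⟪u k, planeMap y' e α β (u k)⟫_ℂ
          = ∑ k, (1 - (1 + α) * (⟪y', u k⟫_ℂ * ⟪u k, y'⟫_ℂ)
              - star β * (⟪e, u k⟫_ℂ * ⟪u k, y'⟫_ℂ) - β * (⟪y', u k⟫_ℂ * ⟪u k, e⟫_ℂ)
              - (1 - star α) * (⟪e, u k⟫_ℂ * ⟪u k, e⟫_ℂ)) := by
            refine Finset.sum_congr rfl fun k _ => ?_
            rw [planeMap_apply]
            simp only [inner_sub_right, inner_smul_right]
            rw [inner_self_eq_norm_sq_to_K, u.norm_eq_one]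
            push_cast
            ring
        _ = _ := by
            simp only [Finset.sum_sub_distrib, ← Finset.mul_sum, h1, hy1, hye, hey]
            simp
    rw [htr]
    -- In the plane the diagonal entries `-α` and `ᾱ` have real parts that cancel, so exactly 2 is
    -- lost. If `e = 0`, the loss is `1 + Re α` with `|α| = 1`, so at most 2.
    rcases he with he | ⟨rfl, rfl⟩
    · rw [he]; simp; linarith
    · have hα : Complex.normSq α = 1 := by
        have h2 : α * star α = 1 := by simpa using hαβ
        rw [Complex.star_def, Complex.mul_conj] at h2
        exact_mod_cast h2
      have : α.re ≤ 1 := by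
        rw [Complex.normSq_apply] at hα
        nlinarith [sq_nonneg α.im]
      simp
      linarith

/-- If `∑ k, s k |f k⟩⟨u k|`, a singular value decomposition with all `s k ≤ S`, is the sum of the
rank-one operators `|z₀⟩⟨w₀|` and `|z i⟩⟨w i|`, then `∑ i, ‖z i‖ ^ 2` is at least
`∑ k, s k - 2 * S + ‖z₀‖ ^ 2`. -/
theorem sum_add_norm_sq_le_of_sum_rankOne {κ m : Type*} [Fintype κ] [Fintype m]
    (u f : OrthonormalBasis κ ℂ E) {s : κ → ℝ} {S : ℝ} (hS₀ : 0 ≤ S) (hS : ∀ k, s k ≤ S)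
    {z₀ w₀ : E} {z w : m → E} (h₀ : ‖w₀‖ = ‖z₀‖) (hzw : ∀ i, ‖w i‖ = ‖z i‖)
    (h : ∀ k, ⟪w₀, u k⟫_ℂ • z₀ + ∑ i, ⟪w i, u k⟫_ℂ • z i = (s k : ℂ) • f k) :
    ∑ k, s k + ‖z₀‖ ^ 2 ≤ 2 * S + ∑ i, ‖z i‖ ^ 2 := by
  -- Composing with `U` turns `∑ s k |f k⟩⟨u k|` into the diagonal operator `∑ s k |u k⟩⟨u k|`.
  set U : E ≃ₗᵢ[ℂ] E := f.equiv u (Equiv.refl κ) with hU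
  have hUf : ∀ k, U (f k) = u k := fun k => by simp [hU]
  obtain ⟨V, hV, hVy, htr⟩ := exists_contraction_map_eq_neg u (y := U z₀) (q := w₀)
    (by rw [U.norm_map, h₀])
  have h1 : ∀ a b : E, ∑ k, ⟪a, u k⟫_ℂ * ⟪u k, b⟫_ℂ = ⟪a, b⟫_ℂ := u.sum_inner_mul_inner
  have hsum : ∑ k, (s k : ℂ) * ⟪u k, V (u k)⟫_ℂ
      = -((‖z₀‖ ^ 2 : ℝ) : ℂ) + ∑ i, ⟪w i, V (U (z i))⟫_ℂ := by
    calc ∑ k, (s k : ℂ) * ⟪u k, V (u k)⟫_ℂ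
        = ∑ k, ⟪u k, V (U ((s k : ℂ) • f k))⟫_ℂ := by
          simp only [map_smul, hUf, inner_smul_right]
      _ = ∑ k, (⟪w₀, u k⟫_ℂ * ⟪u k, V (U z₀)⟫_ℂ
            + ∑ i, ⟪w i, u k⟫_ℂ * ⟪u k, V (U (z i))⟫_ℂ) := by
          simp only [← h, map_add, map_sum, map_smul, inner_add_right, inner_sum, inner_smul_right]
      _ = ⟪w₀, V (U z₀)⟫_ℂ + ∑ i, ⟪w i, V (U (z i))⟫_ℂ := by
          rw [Finset.sum_add_distrib, h1, Finset.sum_comm]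
          simp only [h1]
      _ = _ := by
          rw [hVy, inner_neg_right, inner_self_eq_norm_sq_to_K, h₀]
          push_cast
          rfl
  have hle : ∀ a b : E, (⟪a, V b⟫_ℂ).re ≤ ‖a‖ * ‖b‖ := fun a b =>
    (Complex.re_le_norm _).trans ((norm_inner_le_norm _ _).trans (by gcongr; exact hV b))
  have hre := congrArg Complex.re hsum
  simp only [Complex.add_re, Complex.neg_re, Complex.ofReal_re, Complex.re_sum,
    Complex.re_ofReal_mul] at hre htr
  have hup : ∑ i, (⟪w i, V (U (z i))⟫_ℂ).re ≤ ∑ i, ‖z i‖ ^ 2 :=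
    Finset.sum_le_sum fun i _ => (hle _ _).trans (by rw [U.norm_map, hzw, sq])
  -- Each defect `1 - Re ⟪u k, V (u k)⟫` is nonnegative as `V` is a contraction, and the defects add
  -- up to at most 2 by `htr`.
  have hlow : ∑ k, (s k - S * (1 - (⟪u k, V (u k)⟫_ℂ).re)) ≤ ∑ k, s k * (⟪u k, V (u k)⟫_ℂ).re := by
    refine Finset.sum_le_sum fun k _ => ?_
    have h2 := hle (u k) (u k)
    rw [u.norm_eq_one, one_mul] at h2
    nlinarith [hS k]
  rw [Finset.sum_sub_distrib, ← Finset.mul_sum, Finset.sum_sub_distrib] at hlow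
  simp only [Finset.sum_const, Finset.card_univ, nsmul_eq_mul, mul_one] at hlow
  nlinarith

end RankOne

/-! ### Real quadratic forms of `A A*` and the singular values of `Aᵀ A`. -/

/-- Singular value decomposition of a square matrix. -/
theorem exists_orthonormalBasis_singular {ι : Type*} [Fintype ι] [DecidableEq ι]
    (τ : Matrix ι ι ℂ) :
    ∃ u f : OrthonormalBasis ι ℂ (EuclideanSpace ℂ ι), ∀ k, Matrix.toEuclideanLin τ (u k) =
      ((√((Matrix.isHermitian_conjTranspose_mul_self τ).eigenvalues k) : ℝ) : ℂ) • f k := by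
  set hH := Matrix.isHermitian_conjTranspose_mul_self τ
  set u := hH.eigenvectorBasis
  set T := Matrix.toEuclideanLin τ with hT
  have hnn : ∀ k, 0 ≤ hH.eigenvalues k := Matrix.eigenvalues_conjTranspose_mul_self_nonneg τ
  have hTT : ∀ k, LinearMap.adjoint T (T (u k)) = (hH.eigenvalues k : ℂ) • u k := by
    intro k
    rw [hT, ← Matrix.toEuclideanLin_conjTranspose_eq_adjoint]
    ext i
    have := congrFun (hH.mulVec_eigenvectorBasis k) i
    simpa [Matrix.toLpLin_apply, Matrix.mulVec_mulVec] using this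
  have hin : ∀ j k, ⟪T (u j), T (u k)⟫_ℂ = (hH.eigenvalues k : ℂ) * if j = k then 1 else 0 := by
    intro j k
    rw [← LinearMap.adjoint_inner_right, hTT, inner_smul_right]
    congr 1
    exact orthonormal_iff_ite.mp u.orthonormal j k
  set s : ι → ℝ := fun k => √(hH.eigenvalues k) with hs
  have hss : ∀ k, (s k : ℂ) * s k = hH.eigenvalues k := fun k => by
    rw [← Complex.ofReal_mul, Real.mul_self_sqrt (hnn k)]
  -- Normalized images exist only for nonzero singular values; the others are filled in by extension
  -- to a basis.
  have horth : Orthonormal ℂ ({k | s k ≠ 0}.domRestrict fun k => ((s k : ℂ)⁻¹) • T (u k)) := by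
    rw [orthonormal_iff_ite]
    rintro ⟨j, hj⟩ ⟨k, hk⟩
    have hk' : (s k : ℂ) ≠ 0 := by exact_mod_cast hk
    simp only [Set.domRestrict_apply, inner_smul_left, inner_smul_right, hin, Subtype.mk.injEq,
      map_inv₀, Complex.conj_ofReal]
    split_ifs with hjk
    · subst hjk
      rw [← hss]
      field_simp
    · simp
  obtain ⟨f, hf⟩ := horth.exists_orthonormalBasis_extension_of_card_eq finrank_euclideanSpace
  refine ⟨u, f, fun k => ?_⟩
  change T (u k) = (s k : ℂ) • f k
  by_cases hk : s k = 0
  · have h0 := hin k k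
    rw [← hss, hk] at h0
    rw [hk]
    simpa using h0
  · have hk' : (s k : ℂ) ≠ 0 := by exact_mod_cast hk
    rw [hf k hk, smul_smul, mul_inv_cancel₀ hk', one_smul]

/-- For a real unit vector `v`, the excess of `‖Aᵀ v‖²` over half of the squared Frobenius norm of
`A` is bounded in terms of the singular values of the symmetric matrix `Aᵀ A`. -/
theorem two_mul_norm_sq_le {m ι : Type*} [Fintype m] [Fintype ι] [DecidableEq ι]
    (A : Matrix m ι ℂ) {v : m → ℝ} (hv : ∑ i, v i ^ 2 = 1) {S : ℝ} (hS₀ : 0 ≤ S)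
    (hS : ∀ k, √((Matrix.isHermitian_conjTranspose_mul_self (A.transpose * A)).eigenvalues k) ≤ S) :
    2 * ∑ k, ‖∑ i, (v i : ℂ) * A i k‖ ^ 2 +
      ∑ k, √((Matrix.isHermitian_conjTranspose_mul_self (A.transpose * A)).eigenvalues k) ≤
      2 * S + ∑ i, ∑ k, ‖A i k‖ ^ 2 := by
  obtain ⟨u, f, huf⟩ := exists_orthonormalBasis_singular (A.transpose * A)
  set x : ι → ℂ := fun k => ∑ i, (v i : ℂ) * A i k with hx
  have hvC : ∑ i, (v i : ℂ) ^ 2 = 1 := by exact_mod_cast hv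
  -- The conjugates in `w₀` and `w` make the rank-one terms bilinear: `|x⟩⟨x̄| = x xᵀ`. Subtracting
  -- `v i • x` from row `i` splits off exactly `x xᵀ` because `v` is a real unit vector.
  have key := sum_add_norm_sq_le_of_sum_rankOne u f hS₀ hS
    (z₀ := WithLp.toLp 2 x) (w₀ := WithLp.toLp 2 (star x))
    (z := fun i => WithLp.toLp 2 fun k => A i k - v i * x k)
    (w := fun i => WithLp.toLp 2 (star fun k => A i k - v i * x k))
    (by simp [EuclideanSpace.norm_eq]) (fun i => by
      simp only [EuclideanSpace.norm_eq, Pi.star_apply, norm_star]) (by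
      intro k
      rw [← huf]
      ext l
      simp only [PiLp.add_apply, PiLp.smul_apply, WithLp.ofLp_sum, Finset.sum_apply,
        PiLp.inner_apply, RCLike.inner_apply, Pi.star_apply, smul_eq_mul, Matrix.toLpLin_apply,
        Matrix.mulVec, dotProduct, Matrix.mul_apply, Matrix.transpose_apply, Complex.star_def,
        Complex.conj_conj, WithLp.ofLp_smul, Pi.smul_apply]
      set c : m → ℂ := fun i => ∑ j, A i j * u k j with hc
      have h1 : ∑ j, u k j * x j = ∑ i, v i * c i := by
        simp only [hx, hc, Finset.mul_sum]
        rw [Finset.sum_comm]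
        exact Finset.sum_congr rfl fun i _ => Finset.sum_congr rfl fun j _ => by ring
      have h2 : ∀ i, ∑ j, u k j * (A i j - v i * x j) = c i - v i * ∑ i, v i * c i := by
        intro i
        rw [← h1, hc, Finset.mul_sum, ← Finset.sum_sub_distrib]
        exact Finset.sum_congr rfl fun j _ => by ring
      have h3 : ∑ j, (∑ i, A i l * A i j) * u k j = ∑ i, c i * A i l := by
        simp only [hc, Finset.sum_mul]
        rw [Finset.sum_comm]
        exact Finset.sum_congr rfl fun i _ => Finset.sum_congr rfl fun j _ => by ring
      rw [h3, h1]
      simp only [h2]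
      set X := ∑ i, (v i : ℂ) * c i with hX
      have h4 : ∑ i, (c i - v i * X) * (A i l - v i * x l)
          = ∑ i, c i * A i l - X * x l - X * x l + (∑ i, (v i : ℂ) ^ 2) * (X * x l) := by
        conv_rhs => enter [1, 1, 2]; rw [hx]
        conv_rhs => enter [1, 2]; rw [hX]
        simp only [Finset.mul_sum, Finset.sum_mul, ← Finset.sum_sub_distrib,
          ← Finset.sum_add_distrib]
        exact Finset.sum_congr rfl fun i _ => by ring
      rw [h4, hvC]
      ring)
  simp only [EuclideanSpace.norm_sq_eq] at key
  have h5 : ∑ i, ∑ k, ‖A i k - v i * x k‖ ^ 2 = ∑ i, ∑ k, ‖A i k‖ ^ 2 - ∑ k, ‖x k‖ ^ 2 := by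
    rw [Finset.sum_comm, Finset.sum_comm (f := fun i k => ‖A i k‖ ^ 2), ← Finset.sum_sub_distrib]
    refine Finset.sum_congr rfl fun k _ => ?_
    have hC : ∑ i, (A i k - v i * x k) * star (A i k - v i * x k)
        = ∑ i, A i k * star (A i k) - x k * star (x k) := by
      have h6 : ∑ i, (A i k - v i * x k) * star (A i k - v i * x k)
          = ∑ i, A i k * star (A i k) - x k * star (x k) - x k * star (x k)
            + (∑ i, (v i : ℂ) ^ 2) * (x k * star (x k)) := by
        conv_rhs => enter [1, 1, 2, 1]; rw [hx]
        conv_rhs => enter [1, 2, 2]; rw [hx]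
        simp only [star_sum, Finset.mul_sum, Finset.sum_mul, ← Finset.sum_sub_distrib,
          ← Finset.sum_add_distrib]
        refine Finset.sum_congr rfl fun i _ => ?_
        have : star (v i : ℂ) = v i := Complex.conj_ofReal _
        simp only [star_sub, star_mul', this]
        ring
      rw [h6, hvC]
      ring
    have hn : ∀ z : ℂ, z * star z = ((‖z‖ ^ 2 : ℝ) : ℂ) := fun z => by
      rw [Complex.star_def, Complex.mul_conj, Complex.normSq_eq_norm_sq]
    simp only [hn] at hC
    exact_mod_cast hC
  rw [h5] at key
  linarith

/-! ### The magic basis, concurrence, and the bound on the real part of the state. -/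

/-- The columns, divided by `√2`, form an orthonormal basis of `ℂ² ⊗ ℂ²` of vectors fixed by the
spin flip `v ↦ (σ₂ ⊗ σ₂) v̄`. -/
def magicBasis : Matrix (Fin 2 × Fin 2) (Fin 4) ℂ :=
  Matrix.of fun p => ![![![Complex.I, 1, 0, 0], ![0, 0, 1, Complex.I]],
    ![![0, 0, 1, -Complex.I], ![Complex.I, -1, 0, 0]]] p.1 p.2

theorem magicBasis_mul_conjTranspose :
    magicBasis * magicBasis.conjTranspose =
      (2 : ℂ) • (1 : Matrix (Fin 2 × Fin 2) (Fin 2 × Fin 2) ℂ) := by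
  ext ⟨a, b⟩ ⟨c, d⟩
  fin_cases a <;> fin_cases b <;> fin_cases c <;> fin_cases d <;>
    simp [magicBasis, Matrix.mul_apply, Fin.sum_univ_four] <;> norm_num

theorem magicBasis_map_star_mul_conjTranspose :
    magicBasis.map star * magicBasis.conjTranspose = (2 : ℂ) • (pauli 1 ⊗ₖ pauli 1) := by
  ext ⟨a, b⟩ ⟨c, d⟩
  fin_cases a <;> fin_cases b <;> fin_cases c <;> fin_cases d <;>
    simp [magicBasis, pauli, Matrix.mul_apply, Fin.sum_univ_four] <;> norm_num

theorem pauli_kronecker_map_star : (pauli 1 ⊗ₖ pauli 1).map star = pauli 1 ⊗ₖ pauli 1 := by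
  ext ⟨a, b⟩ ⟨c, d⟩
  fin_cases a <;> fin_cases b <;> fin_cases c <;> fin_cases d <;> simp [pauli]

theorem pauli_kronecker_transpose : (pauli 1 ⊗ₖ pauli 1).transpose = pauli 1 ⊗ₖ pauli 1 := by
  ext ⟨a, b⟩ ⟨c, d⟩
  fin_cases a <;> fin_cases b <;> fin_cases c <;> fin_cases d <;> simp [pauli]

namespace TwoQubitState

/-- The real part of the density matrix in the magic basis. -/
def magicRe (ρ : TwoQubitState) : Matrix (Fin 4) (Fin 4) ℝ :=
  Matrix.of fun i j => ((magicBasis.conjTranspose * ρ.mat * magicBasis) i j).re / 2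

/-- The `μ k` are the sorted eigenvalues of `τ* τ`, so `S = √(μ 0)` is its largest singular value
and `2 S - ∑ √(μ k)` is the expression inside the concurrence. -/
theorem two_mul_sub_sum_le_concurrence (ρ : TwoQubitState)
    {τ : Matrix (Fin 2 × Fin 2) (Fin 2 × Fin 2) ℂ}
    (h : ρ.spinFlipProduct.charpoly = (τ.conjTranspose * τ).charpoly) :
    ∃ S : ℝ, 0 ≤ S ∧
      (∀ k, √((Matrix.isHermitian_conjTranspose_mul_self τ).eigenvalues k) ≤ S) ∧
      2 * S - ∑ k, √((Matrix.isHermitian_conjTranspose_mul_self τ).eigenvalues k)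
        ≤ ρ.concurrence := by
  set hH := Matrix.isHermitian_conjTranspose_mul_self τ
  have hcard : Fintype.card (Fin 2 × Fin 2) = 4 := by simp
  have hsort : ((ρ.spinFlipProduct.charpoly.roots.map Complex.re).sort (· ≥ ·))
      = List.ofFn hH.eigenvalues₀ := by
    rw [h]
    exact hH.sort_roots_charpoly_eq_eigenvalues₀
  have hμ : ∀ k : Fin 4, ρ.μ k = hH.eigenvalues₀ (Fin.cast hcard.symm k) := by
    intro k
    have hk : (k : ℕ) < Fintype.card (Fin 2 × Fin 2) := by rw [hcard]; exact k.2
    -- The list has length four, so the default value of `getD` is never reached.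
    rw [μ, hsort, List.getD_eq_getElem _ _ (by simp), List.getElem_ofFn]
    rfl
  have hsum : ∑ k, √(hH.eigenvalues k) = √(ρ.μ 0) + √(ρ.μ 1) + √(ρ.μ 2) + √(ρ.μ 3) := by
    have h1 : ∑ k, √(hH.eigenvalues k) = ∑ k, √(hH.eigenvalues₀ k) :=
      Equiv.sum_comp (Fintype.equivOfCardEq (Fintype.card_fin _)).symm
        fun k => √(hH.eigenvalues₀ k)
    have h2 : ∑ k, √(hH.eigenvalues₀ k) = ∑ k : Fin 4, √(ρ.μ k) := by
      simp only [hμ]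
      exact (Equiv.sum_comp (finCongr hcard.symm) fun k => √(hH.eigenvalues₀ k)).symm
    rw [h1, h2, Fin.sum_univ_four]
    rfl
  refine ⟨√(ρ.μ 0), Real.sqrt_nonneg _, fun k => ?_, ?_⟩
  · refine Real.sqrt_le_sqrt ?_
    have := hμ 0
    rw [Fin.val_zero] at this
    rw [this]
    exact hH.eigenvalues₀_antitone (Fin.zero_le _)
  · rw [hsum, concurrence]
    refine le_trans (le_of_eq ?_) (le_max_right _ _)
    ring

-- For `ρ = A₀ A₀*`, passing to the magic basis turns the spin flip into plain conjugation, so `Aᵀ A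
-- = A₀ᵀ (σ₂ ⊗ σ₂) A₀`. Cyclic invariance of the characteristic polynomial then moves `A₀` from one
-- end of the spin-flip product to the other.
open scoped MatrixOrder in
theorem exists_factor (ρ : TwoQubitState) :
    ∃ A : Matrix (Fin 4) (Fin 2 × Fin 2) ℂ,
      A * A.conjTranspose = (2 : ℂ)⁻¹ • (magicBasis.conjTranspose * ρ.mat * magicBasis) ∧
      ρ.spinFlipProduct.charpoly =
        ((A.transpose * A).conjTranspose * (A.transpose * A)).charpoly := by
  obtain ⟨B, hB⟩ := CStarAlgebra.nonneg_iff_eq_star_mul_self.mp ρ.posSemidef.nonneg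
  set A₀ : Matrix (Fin 2 × Fin 2) (Fin 2 × Fin 2) ℂ := B.conjTranspose with hA₀
  have hρ : ρ.mat = A₀ * A₀.conjTranspose := by
    rw [hB, hA₀, Matrix.conjTranspose_conjTranspose, Matrix.star_eq_conjTranspose]
  -- The columns of `magicBasis` have norm `√2`; this factor makes the change of basis unitary.
  set c : ℂ := ((√2 : ℝ) : ℂ)⁻¹ with hc
  have hcc : c * c = 2⁻¹ := by
    rw [hc, ← mul_inv, ← Complex.ofReal_mul, Real.mul_self_sqrt (by norm_num)]
    norm_num
  have hcs : star c = c := by simp [hc]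
  set Y := pauli 1 ⊗ₖ pauli 1 with hY
  set A := c • (magicBasis.conjTranspose * A₀) with hA
  have hτ : A.transpose * A = A₀.transpose * Y * A₀ := by
    have : magicBasis.conjTranspose.transpose = magicBasis.map star := by
      rw [Matrix.conjTranspose, Matrix.transpose_map, Matrix.transpose_transpose]
    rw [hY, hA, Matrix.transpose_smul, Matrix.transpose_mul, this, Matrix.smul_mul, Matrix.mul_smul,
      smul_smul, hcc, ← Matrix.mul_assoc, Matrix.mul_assoc A₀.transpose,
      magicBasis_map_star_mul_conjTranspose, Matrix.mul_smul, Matrix.smul_mul, smul_smul]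
    norm_num
  refine ⟨A, ?_, ?_⟩
  · rw [hA, Matrix.conjTranspose_smul, Matrix.smul_mul, Matrix.mul_smul, smul_smul, hcs, hcc, hρ,
      Matrix.conjTranspose_mul, Matrix.conjTranspose_conjTranspose magicBasis]
    simp only [Matrix.mul_assoc]
  · have hYs : Y.conjTranspose = Y := by
      rw [Matrix.conjTranspose, pauli_kronecker_transpose, pauli_kronecker_map_star]
    rw [hτ, Matrix.conjTranspose_mul, Matrix.conjTranspose_mul, hYs,
      spinFlipProduct, ← hY, hρ, Matrix.transpose_mul]
    have h1 : A₀ * A₀.conjTranspose * Y * (A₀.conjTranspose.transpose * A₀.transpose) * Y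
        = A₀ * (A₀.conjTranspose * Y * A₀.conjTranspose.transpose * A₀.transpose * Y) := by
      simp only [Matrix.mul_assoc]
    have h2 : A₀.transpose.conjTranspose = A₀.conjTranspose.transpose := by
      ext i j; simp
    rw [h1, Matrix.charpoly_mul_comm, h2]
    simp only [Matrix.mul_assoc]

/-- For real `v` the form equals `‖Aᵀ v‖²`, and the Frobenius norm of `A` is 1 since `ρ` has trace
one. `two_mul_norm_sq_le` applied to `v / ‖v‖` then gives the upper bound. -/
theorem dotProduct_magicRe_mulVec_mem (ρ : TwoQubitState) (v : Fin 4 → ℝ) :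
    0 ≤ v ⬝ᵥ ρ.magicRe.mulVec v ∧
      v ⬝ᵥ ρ.magicRe.mulVec v ≤ (1 + ρ.concurrence) / 2 * (v ⬝ᵥ v) := by
  obtain ⟨A, hA, hchar⟩ := ρ.exists_factor
  have hn : ∀ z : ℂ, z * star z = ((‖z‖ ^ 2 : ℝ) : ℂ) := fun z => by
    rw [Complex.star_def, Complex.mul_conj, Complex.normSq_eq_norm_sq]
  have hq : ∀ v : Fin 4 → ℝ,
      v ⬝ᵥ ρ.magicRe.mulVec v = ∑ k, ‖∑ i, (v i : ℂ) * A i k‖ ^ 2 := by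
    intro v
    have h1 : ∀ i j, ρ.magicRe i j = ((A * A.conjTranspose) i j).re := by
      intro i j
      rw [hA, magicRe, Matrix.of_apply, Matrix.smul_apply, smul_eq_mul,
        show (2 : ℂ)⁻¹ = ((2⁻¹ : ℝ) : ℂ) by norm_num, Complex.re_ofReal_mul]
      ring
    have h2 : ∑ i, ∑ j, (v i : ℂ) * ((A * A.conjTranspose) i j * v j)
        = ∑ k, ((‖∑ i, (v i : ℂ) * A i k‖ ^ 2 : ℝ) : ℂ) := by
      simp only [← hn, Matrix.mul_apply, Matrix.conjTranspose_apply, star_sum, Finset.mul_sum,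
        Finset.sum_mul, star_mul']
      rw [Finset.sum_comm]
      conv_rhs => rw [Finset.sum_comm]
      refine Finset.sum_congr rfl fun i _ => ?_
      rw [Finset.sum_comm]
      refine Finset.sum_congr rfl fun j _ => Finset.sum_congr rfl fun k _ => ?_
      have : star (v i : ℂ) = v i := Complex.conj_ofReal _
      rw [this]
      ring
    have h3 := congrArg Complex.re h2
    simp only [Complex.re_sum, Complex.re_ofReal_mul, Complex.re_mul_ofReal,
      Complex.ofReal_re] at h3
    rw [← h3]
    simp only [dotProduct, Matrix.mulVec, h1, Finset.mul_sum]
  have hF : ∑ i, ∑ k, ‖A i k‖ ^ 2 = 1 := by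
    have h1 : (A * A.conjTranspose).trace = 1 := by
      rw [hA, Matrix.trace_smul, Matrix.trace_mul_cycle, magicBasis_mul_conjTranspose,
        Matrix.smul_mul, Matrix.one_mul, Matrix.trace_smul, ρ.trace_eq_one]
      norm_num
    simp only [Matrix.trace, Matrix.diag_apply, Matrix.mul_apply, Matrix.conjTranspose_apply,
      hn] at h1
    exact_mod_cast h1
  obtain ⟨S, hS₀, hS, hC⟩ := ρ.two_mul_sub_sum_le_concurrence hchar
  refine ⟨by rw [hq]; positivity, ?_⟩
  rcases eq_or_ne v 0 with rfl | hv
  · simp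
  have hvv : 0 < v ⬝ᵥ v := by
    have : 0 ≤ v ⬝ᵥ v := by
      simp only [dotProduct]
      exact Finset.sum_nonneg fun i _ => mul_self_nonneg _
    exact this.lt_of_ne' fun h => hv (dotProduct_self_eq_zero.mp h)
  set r := √(v ⬝ᵥ v) with hr
  have hr2 : r * r = v ⬝ᵥ v := Real.mul_self_sqrt hvv.le
  have hr0 : r ≠ 0 := (Real.sqrt_pos.mpr hvv).ne'
  have hunit : ∑ i, (r⁻¹ • v) i ^ 2 = 1 := by
    simp only [Pi.smul_apply, smul_eq_mul, mul_pow, ← Finset.mul_sum]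
    have : ∑ i, v i ^ 2 = r * r := by rw [hr2]; simp [dotProduct, sq]
    rw [this]
    field_simp
  have key := two_mul_norm_sq_le A hunit hS₀ hS
  rw [← hq, hF, Matrix.mulVec_smul, smul_dotProduct, dotProduct_smul, smul_eq_mul,
    smul_eq_mul] at key
  have h4 : v ⬝ᵥ ρ.magicRe.mulVec v
      = (r * r) * (r⁻¹ * (r⁻¹ * (v ⬝ᵥ ρ.magicRe.mulVec v))) := by field_simp
  rw [h4, ← hr2, mul_comm ((1 + ρ.concurrence) / 2)]
  exact mul_le_mul_of_nonneg_left (by linarith) (mul_self_nonneg r)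

end TwoQubitState

/-! ### Local Pauli operators as commuting quaternion actions on `ℝ⁴`. -/

/-- `∑ k, a k • (σ k ⊗ 1)`, in the magic basis and divided by `i`. -/
def leftMul (a : Fin 3 → ℝ) : Matrix (Fin 4) (Fin 4) ℝ :=
  !![0, -a 2, -a 0, a 1; a 2, 0, -a 1, -a 0; a 0, a 1, 0, a 2; -a 1, a 0, -a 2, 0]

/-- `∑ k, b k • (1 ⊗ σ k)`, in the magic basis and divided by `-i`. -/
def rightMul (b : Fin 3 → ℝ) : Matrix (Fin 4) (Fin 4) ℝ :=
  !![0, b 2, b 0, b 1; -b 2, 0, b 1, -b 0; -b 0, -b 1, 0, b 2; -b 1, b 0, -b 2, 0]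

theorem leftMul_transpose (a : Fin 3 → ℝ) : (leftMul a).transpose = -leftMul a := by
  ext i j; fin_cases i <;> fin_cases j <;> simp [leftMul]

theorem rightMul_transpose (b : Fin 3 → ℝ) : (rightMul b).transpose = -rightMul b := by
  ext i j; fin_cases i <;> fin_cases j <;> simp [rightMul]

theorem leftMul_mul_leftMul_add (a a' : Fin 3 → ℝ) :
    leftMul a * leftMul a' + leftMul a' * leftMul a
      = (-2 * (a ⬝ᵥ a')) • (1 : Matrix (Fin 4) (Fin 4) ℝ) := by
  ext i j
  fin_cases i <;> fin_cases j <;>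
    simp [leftMul, dotProduct, Fin.sum_univ_three] <;> ring

theorem rightMul_mul_rightMul_add (b b' : Fin 3 → ℝ) :
    rightMul b * rightMul b' + rightMul b' * rightMul b
      = (-2 * (b ⬝ᵥ b')) • (1 : Matrix (Fin 4) (Fin 4) ℝ) := by
  ext i j
  fin_cases i <;> fin_cases j <;>
    simp [rightMul, dotProduct, Fin.sum_univ_three] <;> ring

theorem leftMul_mul_rightMul_comm (a b : Fin 3 → ℝ) :
    rightMul b * leftMul a = leftMul a * rightMul b := by
  ext i j
  fin_cases i <;> fin_cases j <;>
    simp [leftMul, rightMul, Matrix.mul_apply, Fin.sum_univ_four] <;> ring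

theorem trace_leftMul_mul_rightMul (a b : Fin 3 → ℝ) : (leftMul a * rightMul b).trace = 0 := by
  simp [leftMul, rightMul, Matrix.trace, Fin.sum_univ_four]; ring

theorem trace_leftMul_mul_rightMul_mul (a b a' b' : Fin 3 → ℝ) :
    (leftMul a * rightMul b * (leftMul a' * rightMul b')).trace
      = 4 * (a ⬝ᵥ a') * (b ⬝ᵥ b') := by
  have h : leftMul a * rightMul b * (leftMul a' * rightMul b')
      = leftMul a * leftMul a' * (rightMul b * rightMul b') := by
    rw [Matrix.mul_assoc, ← Matrix.mul_assoc (rightMul b), leftMul_mul_rightMul_comm a' b]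
    simp only [Matrix.mul_assoc]
  rw [h]
  simp [leftMul, rightMul, Matrix.trace, Fin.sum_univ_four, dotProduct,
    Fin.sum_univ_three]
  ring

/-- `(∑ k, a k • σ k) ⊗ (∑ l, b l • σ l)` in the magic basis. -/
def pauliTensor (a b : Fin 3 → ℝ) : Matrix (Fin 4) (Fin 4) ℝ := leftMul a * rightMul b

theorem pauliTensor_transpose (a b : Fin 3 → ℝ) :
    (pauliTensor a b).transpose = pauliTensor a b := by
  rw [pauliTensor, Matrix.transpose_mul, leftMul_transpose, rightMul_transpose, neg_mul_neg,
    leftMul_mul_rightMul_comm]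

theorem pauliTensor_mul (a b a' b' : Fin 3 → ℝ) : pauliTensor a b * pauliTensor a' b'
    = leftMul a * leftMul a' * (rightMul b * rightMul b') := by
  rw [pauliTensor, pauliTensor, Matrix.mul_assoc, ← Matrix.mul_assoc (rightMul b),
    leftMul_mul_rightMul_comm a' b]
  simp only [Matrix.mul_assoc]

theorem pauliTensor_mul_self {a b : Fin 3 → ℝ} (ha : a ⬝ᵥ a = 1) (hb : b ⬝ᵥ b = 1) :
    pauliTensor a b * pauliTensor a b = 1 := by
  have h1 : leftMul a * leftMul a = -1 := by
    have := leftMul_mul_leftMul_add a a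
    rw [ha, ← two_smul ℝ] at this
    have h := congrArg (fun M => (2⁻¹ : ℝ) • M) this
    simpa [smul_smul] using h
  have h2 : rightMul b * rightMul b = -1 := by
    have := rightMul_mul_rightMul_add b b
    rw [hb, ← two_smul ℝ] at this
    have h := congrArg (fun M => (2⁻¹ : ℝ) • M) this
    simpa [smul_smul] using h
  rw [pauliTensor_mul, h1, h2]
  simp

/-- Both tensor factors anticommute, and the two signs cancel. -/
theorem pauliTensor_mul_comm {a b a' b' : Fin 3 → ℝ} (ha : a ⬝ᵥ a' = 0) (hb : b ⬝ᵥ b' = 0) :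
    pauliTensor a b * pauliTensor a' b' = pauliTensor a' b' * pauliTensor a b := by
  have h1 : leftMul a * leftMul a' = -(leftMul a' * leftMul a) := by
    rw [eq_neg_iff_add_eq_zero, leftMul_mul_leftMul_add, ha]; simp
  have h2 : rightMul b * rightMul b' = -(rightMul b' * rightMul b) := by
    rw [eq_neg_iff_add_eq_zero, rightMul_mul_rightMul_add, hb]; simp
  rw [pauliTensor_mul, pauliTensor_mul, h1, h2, neg_mul_neg]

theorem pauli_kronecker_one_mul_magicBasis (k : Fin 3) :
    (pauli k ⊗ₖ (1 : Matrix (Fin 2) (Fin 2) ℂ)) * magicBasis =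
      Complex.I • (magicBasis * (leftMul (Pi.single k 1)).map Complex.ofReal) := by
  ext ⟨a, b⟩ j
  fin_cases k <;> fin_cases a <;> fin_cases b <;> fin_cases j <;>
    simp [pauli, magicBasis, leftMul, Matrix.mul_apply, Fin.sum_univ_four, Fintype.sum_prod_type]

theorem one_kronecker_pauli_mul_magicBasis (k : Fin 3) :
    ((1 : Matrix (Fin 2) (Fin 2) ℂ) ⊗ₖ pauli k) * magicBasis =
      (-Complex.I) • (magicBasis * (rightMul (Pi.single k 1)).map Complex.ofReal) := by
  ext ⟨a, b⟩ j
  fin_cases k <;> fin_cases a <;> fin_cases b <;> fin_cases j <;>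
    simp [pauli, magicBasis, rightMul, Matrix.mul_apply, Fin.sum_univ_four, Fintype.sum_prod_type]

/-! ### Correlations as expectations of real projections. -/

namespace TwoQubitState

/-- The observable is real in the magic basis, so the real part of the trace sees only the real part
of the state. -/
theorem correlationTensor_eq_trace (ρ : TwoQubitState) (k l : Fin 3) :
    ρ.correlationTensor k l =
      (ρ.magicRe * pauliTensor (Pi.single k 1) (Pi.single l 1)).trace := by
  set G := pauliTensor (Pi.single k 1) (Pi.single l 1) with hG
  have h1 : (pauli k ⊗ₖ pauli l) * magicBasis = magicBasis * G.map Complex.ofReal := by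
    have : pauli k ⊗ₖ pauli l = (pauli k ⊗ₖ 1) * ((1 : Matrix (Fin 2) (Fin 2) ℂ) ⊗ₖ pauli l) := by
      rw [← Matrix.mul_kronecker_mul, Matrix.mul_one, Matrix.one_mul]
    have hmap : G.map Complex.ofReal = (leftMul (Pi.single k 1)).map Complex.ofReal *
        (rightMul (Pi.single l 1)).map Complex.ofReal :=
      Matrix.map_mul (f := Complex.ofRealHom)
    rw [this, Matrix.mul_assoc, one_kronecker_pauli_mul_magicBasis, Matrix.mul_smul,
      ← Matrix.mul_assoc, pauli_kronecker_one_mul_magicBasis, Matrix.smul_mul, smul_smul,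
      hmap, Matrix.mul_assoc]
    simp
  have h2 : (ρ.mat * (pauli k ⊗ₖ pauli l)).trace =
      2⁻¹ * (magicBasis.conjTranspose * ρ.mat * magicBasis * G.map Complex.ofReal).trace := by
    rw [Matrix.mul_assoc _ magicBasis, ← h1, Matrix.mul_assoc,
      Matrix.trace_mul_comm magicBasis.conjTranspose, Matrix.mul_assoc, Matrix.mul_assoc,
      magicBasis_mul_conjTranspose, Matrix.mul_smul,
      Matrix.mul_one, Matrix.mul_smul, Matrix.trace_smul]
    simp
  rw [correlationTensor, Matrix.of_apply, h2, show (2 : ℂ)⁻¹ = ((2⁻¹ : ℝ) : ℂ) by norm_num,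
    Complex.re_ofReal_mul]
  simp only [Matrix.trace, Matrix.diag_apply, Matrix.mul_apply (N := G),
    Matrix.mul_apply (N := G.map Complex.ofReal), Matrix.map_apply, Complex.re_sum,
    Complex.re_mul_ofReal, magicRe, Matrix.of_apply, Finset.mul_sum]
  exact Finset.sum_congr rfl fun i _ => Finset.sum_congr rfl fun j _ => by ring

theorem trace_magicRe (ρ : TwoQubitState) : ρ.magicRe.trace = 1 := by
  have h := congrArg Complex.re ρ.trace_eq_one
  simp [Matrix.trace, Fintype.sum_prod_type] at h
  simp [magicRe, magicBasis, Matrix.trace, Matrix.mul_apply, Fin.sum_univ_four,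
    Fintype.sum_prod_type]
  linarith

theorem dotProduct_correlationTensor_mulVec (ρ : TwoQubitState) (a b : Fin 3 → ℝ) :
    a ⬝ᵥ ρ.correlationTensor.mulVec b = (ρ.magicRe * pauliTensor a b).trace := by
  simp only [dotProduct, Matrix.mulVec, correlationTensor_eq_trace]
  generalize ρ.magicRe = S
  simp [pauliTensor, leftMul, rightMul, Matrix.trace, Matrix.mul_apply, Fin.sum_univ_four,
    Fin.sum_univ_three]
  ring

theorem trace_magicRe_mul_eq_sum (ρ : TwoQubitState) {Q : Matrix (Fin 4) (Fin 4) ℝ}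
    (hsymm : Q.transpose = Q) (hQ : Q * Q = Q) :
    (ρ.magicRe * Q).trace = ∑ i, Q i ⬝ᵥ ρ.magicRe.mulVec (Q i) := by
  -- Conjugating by the projection turns the trace into a sum of quadratic forms in the rows of `Q`.
  have : (ρ.magicRe * Q).trace = (Q * (ρ.magicRe * Q.transpose)).trace := by
    rw [Matrix.trace_mul_comm Q, Matrix.mul_assoc, hsymm, hQ]
  rw [this]
  rfl

theorem trace_magicRe_mul_nonneg (ρ : TwoQubitState) {Q : Matrix (Fin 4) (Fin 4) ℝ}
    (hsymm : Q.transpose = Q) (hQ : Q * Q = Q) : 0 ≤ (ρ.magicRe * Q).trace := by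
  rw [ρ.trace_magicRe_mul_eq_sum hsymm hQ]
  exact Finset.sum_nonneg fun i _ => (ρ.dotProduct_magicRe_mulVec_mem _).1

/-- A projection of trace one that is real in the magic basis has expectation at most
`(1 + C) / 2`. -/
theorem trace_magicRe_mul_le (ρ : TwoQubitState) {Q : Matrix (Fin 4) (Fin 4) ℝ}
    (hsymm : Q.transpose = Q) (hQ : Q * Q = Q) (htr : Q.trace = 1) :
    (ρ.magicRe * Q).trace ≤ (1 + ρ.concurrence) / 2 := by
  have h2 : ∑ i, Q i ⬝ᵥ Q i = 1 := by
    have : Q.trace = (Q * Q.transpose).trace := by rw [hsymm, hQ]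
    rw [← htr, this]
    rfl
  rw [ρ.trace_magicRe_mul_eq_sum hsymm hQ]
  calc _ ≤ ∑ i, (1 + ρ.concurrence) / 2 * (Q i ⬝ᵥ Q i) :=
        Finset.sum_le_sum fun i _ => (ρ.dotProduct_magicRe_mulVec_mem _).2
    _ = _ := by rw [← Finset.mul_sum, h2, mul_one]

theorem trace_pauliTensor_projection_mem (ρ : TwoQubitState) {a b a' b' : Fin 3 → ℝ}
    (ha : a ⬝ᵥ a = 1) (hb : b ⬝ᵥ b = 1) (ha' : a' ⬝ᵥ a' = 1) (hb' : b' ⬝ᵥ b' = 1)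
    (haa' : a ⬝ᵥ a' = 0) (hbb' : b ⬝ᵥ b' = 0) {s t : ℝ} (hs : s * s = 1) (ht : t * t = 1) :
    0 ≤ 1 + s * (ρ.magicRe * pauliTensor a b).trace + t * (ρ.magicRe * pauliTensor a' b').trace
        + s * t * (ρ.magicRe * (pauliTensor a b * pauliTensor a' b')).trace ∧
    1 + s * (ρ.magicRe * pauliTensor a b).trace + t * (ρ.magicRe * pauliTensor a' b').trace
        + s * t * (ρ.magicRe * (pauliTensor a b * pauliTensor a' b')).trace
      ≤ 2 * (1 + ρ.concurrence) := by
  have hXt := pauliTensor_transpose a b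
  have hZt := pauliTensor_transpose a' b'
  have hXX := pauliTensor_mul_self ha hb
  have hZZ := pauliTensor_mul_self ha' hb'
  have hXZ := pauliTensor_mul_comm haa' hbb'
  have htX : (pauliTensor a b).trace = 0 := trace_leftMul_mul_rightMul a b
  have htZ : (pauliTensor a' b').trace = 0 := trace_leftMul_mul_rightMul a' b'
  have htXZ : (pauliTensor a b * pauliTensor a' b').trace = 0 := by
    have := trace_leftMul_mul_rightMul_mul a b a' b'
    rw [haa'] at this
    simpa [pauliTensor] using this
  generalize pauliTensor a b = X at *
  generalize pauliTensor a' b' = Z at *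
  -- This is `(1 + sX)(1 + tZ) / 4`, the projection onto the joint eigenspace `X = s`, `Z = t`. It
  -- has trace one because `X`, `Z` and `X Z` are traceless.
  set Q : Matrix (Fin 4) (Fin 4) ℝ := (4⁻¹ : ℝ) • (1 + s • X + t • Z + (s * t) • (X * Z)) with hQ
  have hsymm : Q.transpose = Q := by
    rw [hQ]
    simp only [Matrix.transpose_smul, Matrix.transpose_add, Matrix.transpose_one,
      Matrix.transpose_mul, hXt, hZt, ← hXZ]
  have hXY : X * (X * Z) = Z := by rw [← Matrix.mul_assoc, hXX, Matrix.one_mul]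
  have hYX : X * Z * X = Z := by rw [hXZ, Matrix.mul_assoc, hXX, Matrix.mul_one]
  have hYZ : X * Z * Z = X := by rw [Matrix.mul_assoc, hZZ, Matrix.mul_one]
  have hZY : Z * (X * Z) = X := by rw [hXZ, ← Matrix.mul_assoc, hZZ, Matrix.one_mul]
  have hYY : X * Z * (X * Z) = 1 := by rw [Matrix.mul_assoc, hZY, hXX]
  have hidem : Q * Q = Q := by
    rw [hQ]
    simp only [Matrix.smul_mul, Matrix.mul_smul, Matrix.add_mul, Matrix.mul_add, Matrix.one_mul,
      Matrix.mul_one, hXY, hYX, hYZ, hZY, hYY, hXX, hZZ, ← hXZ, smul_add, smul_smul]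
    match_scalars
    · linear_combination 16⁻¹ * hs + 8⁻¹ * ht + 16⁻¹ * t * t * hs
    · linear_combination 8⁻¹ * s * ht
    · linear_combination 8⁻¹ * t * hs
    · ring
  have htr : Q.trace = 1 := by
    rw [hQ]
    simp only [Matrix.trace_smul, Matrix.trace_add, htX, htZ, htXZ, Matrix.trace_one]
    norm_num
  have hlow := ρ.trace_magicRe_mul_nonneg hsymm hidem
  have hup := ρ.trace_magicRe_mul_le hsymm hidem htr
  have h : (ρ.magicRe * Q).trace = 4⁻¹ * (1 + s * (ρ.magicRe * X).trace
      + t * (ρ.magicRe * Z).trace + s * t * (ρ.magicRe * (X * Z)).trace) := by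
    rw [hQ]
    simp only [Matrix.mul_smul, Matrix.mul_add, Matrix.mul_one, Matrix.trace_smul,
      Matrix.trace_add, ρ.trace_magicRe, smul_eq_mul]
  rw [h] at hlow hup
  constructor <;> linarith

theorem sq_add_sq_le_of_orthonormal (ρ : TwoQubitState) {a b a' b' : Fin 3 → ℝ}
    (ha : a ⬝ᵥ a = 1) (hb : b ⬝ᵥ b = 1) (ha' : a' ⬝ᵥ a' = 1) (hb' : b' ⬝ᵥ b' = 1)
    (haa' : a ⬝ᵥ a' = 0) (hbb' : b ⬝ᵥ b' = 0) :
    (a ⬝ᵥ ρ.correlationTensor.mulVec b) ^ 2 + (a' ⬝ᵥ ρ.correlationTensor.mulVec b') ^ 2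
      ≤ 1 + ρ.concurrence ^ 2 := by
  have hC : 0 ≤ ρ.concurrence := le_max_left _ _
  rw [dotProduct_correlationTensor_mulVec, dotProduct_correlationTensor_mulVec]
  have key := fun {s t : ℝ} (hs : s * s = 1) (ht : t * t = 1) =>
    ρ.trace_pauliTensor_projection_mem ha hb ha' hb' haa' hbb' hs ht
  obtain ⟨h1, h1'⟩ := key (s := 1) (t := 1) (by norm_num) (by norm_num)
  obtain ⟨h2, h2'⟩ := key (s := 1) (t := -1) (by norm_num) (by norm_num)
  obtain ⟨h3, h3'⟩ := key (s := -1) (t := 1) (by norm_num) (by norm_num)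
  obtain ⟨h4, h4'⟩ := key (s := -1) (t := -1) (by norm_num) (by norm_num)
  generalize (ρ.magicRe * pauliTensor a b).trace = x at *
  generalize (ρ.magicRe * pauliTensor a' b').trace = z at *
  generalize (ρ.magicRe * (pauliTensor a b * pauliTensor a' b')).trace = y at *
  generalize ρ.concurrence = C at *
  have hx : |x| ≤ 1 := abs_le.mpr ⟨by linarith, by linarith⟩
  have hz : |z| ≤ 1 := abs_le.mpr ⟨by linarith, by linarith⟩
  -- With `s, t` the signs of `x, z`, subtract the lower bound at `(-s, -t)` from the upper bound at
  -- `(s, t)`; the `y` terms cancel.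
  have hxz : |x| + |z| ≤ 1 + C := by
    rcases abs_cases x with ⟨hx', -⟩ | ⟨hx', -⟩ <;> rcases abs_cases z with ⟨hz', -⟩ | ⟨hz', -⟩ <;>
      rw [hx', hz'] <;> linarith
  rw [← sq_abs x, ← sq_abs z]
  have hx0 := abs_nonneg x
  have hz0 := abs_nonneg z
  rcases le_total |z| C with h | h
  · nlinarith
  -- Replacing `|x|` by `1 + C - |z|` leaves the slack `2 (1 - |z|)(|z| - C)`.
  · nlinarith [mul_nonneg (sub_nonneg.mpr hz) (sub_nonneg.mpr h)]

/-- The bound `|Tr[ρ (a · σ ⊗ b · σ)]| ≤ 1`. -/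
theorem sq_dotProduct_correlationTensor_mulVec_le_one (ρ : TwoQubitState) {a b : Fin 3 → ℝ}
    (ha : a ⬝ᵥ a = 1) (hb : b ⬝ᵥ b = 1) : (a ⬝ᵥ ρ.correlationTensor.mulVec b) ^ 2 ≤ 1 := by
  rw [dotProduct_correlationTensor_mulVec]
  have h : ∀ s : ℝ, s * s = 1 → 0 ≤ 1 + s * (ρ.magicRe * pauliTensor a b).trace := by
    intro s hs
    set X := pauliTensor a b with hX
    have hXt : X.transpose = X := pauliTensor_transpose a b
    have hXX : X * X = 1 := pauliTensor_mul_self ha hb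
    set Q : Matrix (Fin 4) (Fin 4) ℝ := (2⁻¹ : ℝ) • (1 + s • X) with hQ
    have hsymm : Q.transpose = Q := by
      simp only [hQ, Matrix.transpose_smul, Matrix.transpose_add, Matrix.transpose_one, hXt]
    have hidem : Q * Q = Q := by
      rw [hQ]
      simp only [Matrix.smul_mul, Matrix.mul_smul, Matrix.add_mul, Matrix.mul_add, Matrix.one_mul,
        Matrix.mul_one, hXX, smul_add, smul_smul]
      match_scalars
      · linear_combination 4⁻¹ * hs
      · ring
    have h1 := ρ.trace_magicRe_mul_nonneg hsymm hidem
    have h2 : (ρ.magicRe * Q).trace = 2⁻¹ * (1 + s * (ρ.magicRe * X).trace) := by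
      rw [hQ]
      simp only [Matrix.mul_smul, Matrix.mul_add, Matrix.mul_one, Matrix.trace_smul,
        Matrix.trace_add, ρ.trace_magicRe, smul_eq_mul]
    linarith
  have h1 := h 1 (by norm_num)
  have h2 := h (-1) (by norm_num)
  nlinarith

/-! ### Singular vectors of the correlation tensor and the bound for one state. -/

theorem E_nonneg (ρ : TwoQubitState) (k : ℕ) : 0 ≤ ρ.E k :=
  LinearMap.singularValues_nonneg _ k

theorem E_antitone (ρ : TwoQubitState) : Antitone ρ.E :=
  LinearMap.singularValues_antitone _

/-- Orthonormal eigenvectors of `Rᵀ R` have orthogonal images under `R`. -/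
theorem exists_right_singular_vectors (ρ : TwoQubitState) :
    ∃ b : Fin 3 → Fin 3 → ℝ, (∀ i j, b i ⬝ᵥ b j = if i = j then 1 else 0) ∧
      ∀ i j, ρ.correlationTensor.mulVec (b i) ⬝ᵥ ρ.correlationTensor.mulVec (b j)
        = if i = j then ρ.E i ^ 2 else 0 := by
  set T := Matrix.toEuclideanLin ρ.correlationTensor with hT
  have hn : Module.finrank ℝ (EuclideanSpace ℝ (Fin 3)) = 3 := finrank_euclideanSpace_fin
  set u := T.isSymmetric_adjoint_comp_self.eigenvectorBasis hn with hu
  have hdot : ∀ x y : EuclideanSpace ℝ (Fin 3), WithLp.ofLp x ⬝ᵥ WithLp.ofLp y = ⟪x, y⟫_ℝ := by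
    intro x y
    rw [EuclideanSpace.inner_eq_star_dotProduct, star_trivial, dotProduct_comm]
  have hu' : ∀ i j, ⟪u i, u j⟫_ℝ = if i = j then 1 else 0 := orthonormal_iff_ite.mp u.orthonormal
  refine ⟨fun i => WithLp.ofLp (u i), fun i j => by rw [hdot, hu'], fun i j => ?_⟩
  have hTu : ∀ i, ρ.correlationTensor.mulVec (WithLp.ofLp (u i)) = WithLp.ofLp (T (u i)) :=
    fun i => rfl
  have heig : LinearMap.adjoint T (T (u j)) =
      T.isSymmetric_adjoint_comp_self.eigenvalues hn j • u j :=
    T.isSymmetric_adjoint_comp_self.apply_eigenvectorBasis hn j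
  rw [hTu, hTu, hdot, ← LinearMap.adjoint_inner_right, heig, inner_smul_right, hu',
    ← T.sq_singularValues_fin hn]
  split_ifs with h
  · rw [h, mul_one]; rfl
  · rw [mul_zero]

/-- The left singular vectors are `R b / E`, defined only when `E ≠ 0`. If `E 1` vanishes, the bound
`E 0 ≤ 1` suffices. -/
theorem E_zero_sq_add_E_one_sq_le (ρ : TwoQubitState) :
    ρ.E 0 ^ 2 + ρ.E 1 ^ 2 ≤ 1 + ρ.concurrence ^ 2 := by
  obtain ⟨b, hb, hR⟩ := ρ.exists_right_singular_vectors
  have hb0 : b 0 ⬝ᵥ b 0 = 1 := by simp [hb]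
  have hb1 : b 1 ⬝ᵥ b 1 = 1 := by simp [hb]
  have hb01 : b 0 ⬝ᵥ b 1 = 0 := by simp [hb]
  have hR0 := hR 0 0
  have hR1 := hR 1 1
  have hR01 := hR 0 1
  simp only [if_true, Fin.isValue, zero_ne_one, if_false, Fin.val_zero, Fin.val_one] at hR0 hR1 hR01
  set r₀ := ρ.correlationTensor.mulVec (b 0) with hr₀
  set r₁ := ρ.correlationTensor.mulVec (b 1) with hr₁
  have hanti : ρ.E 1 ≤ ρ.E 0 := ρ.E_antitone zero_le_one
  rcases (ρ.E_nonneg 0).eq_or_lt with h0 | h0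
  · have h1 : ρ.E 1 = 0 := le_antisymm (h0 ▸ hanti) (ρ.E_nonneg 1)
    rw [← h0, h1]
    nlinarith [sq_nonneg ρ.concurrence]
  have ha0 : ((ρ.E 0)⁻¹ • r₀) ⬝ᵥ ((ρ.E 0)⁻¹ • r₀) = 1 := by
    rw [smul_dotProduct, dotProduct_smul, hR0, smul_eq_mul, smul_eq_mul]
    field_simp
  have hE0 : ((ρ.E 0)⁻¹ • r₀) ⬝ᵥ r₀ = ρ.E 0 := by
    rw [smul_dotProduct, hR0, smul_eq_mul]
    field_simp
  rcases (ρ.E_nonneg 1).eq_or_lt with h1 | h1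
  · have := ρ.sq_dotProduct_correlationTensor_mulVec_le_one ha0 hb0
    rw [← hr₀, hE0] at this
    rw [← h1]
    nlinarith [sq_nonneg ρ.concurrence]
  have ha1 : ((ρ.E 1)⁻¹ • r₁) ⬝ᵥ ((ρ.E 1)⁻¹ • r₁) = 1 := by
    rw [smul_dotProduct, dotProduct_smul, hR1, smul_eq_mul, smul_eq_mul]
    field_simp
  have hE1 : ((ρ.E 1)⁻¹ • r₁) ⬝ᵥ r₁ = ρ.E 1 := by
    rw [smul_dotProduct, hR1, smul_eq_mul]
    field_simp
  have ha01 : ((ρ.E 0)⁻¹ • r₀) ⬝ᵥ ((ρ.E 1)⁻¹ • r₁) = 0 := by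
    rw [smul_dotProduct, dotProduct_smul, hR01, smul_zero, smul_zero]
  have := ρ.sq_add_sq_le_of_orthonormal ha0 hb0 ha1 hb1 ha01 hb01
  rwa [← hr₀, ← hr₁, hE0, hE1] at this

end TwoQubitState

/-! ### From one source to the star network. -/

theorem prod_rpow_two_div_le {n : ℕ} (hn : 1 ≤ n) {x : Fin n → ℝ} (hx : ∀ j, 0 ≤ x j) :
    (∏ j, x j) ^ ((2 : ℝ) / n) ≤ (1 / (n : ℝ)) * ∑ j, x j ^ 2 := by
  have hn0 : (n : ℝ) ≠ 0 := by positivity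
  -- AM–GM is applied to the squares `x j ^ 2`, which produces the exponent `2 / n`.
  have h := Real.geom_mean_le_arith_mean_weighted Finset.univ (fun _ : Fin n => 1 / (n : ℝ))
    (fun j => x j ^ 2) (fun _ _ => by positivity) (by simp [hn0]) (fun j _ => sq_nonneg _)
  rw [← Finset.mul_sum] at h
  refine le_trans (le_of_eq ?_) h
  rw [← Real.finsetProd_rpow _ _ fun j _ => hx j]
  refine Finset.prod_congr rfl fun j _ => ?_
  rw [← Real.rpow_natCast, ← Real.rpow_mul (hx j)]
  congr 1
  push_cast
  ring

end StarNetwork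

end


theorem theorem4 (n : ℕ) (hn : 1 ≤ n) (ρ : Fin n → StarNetwork.TwoQubitState) :
    StarNetwork.starB ρ ≤ √(1 + (1 / (n : ℝ)) * ∑ i, (ρ i).concurrence ^ 2) := by
  refine Real.sqrt_le_sqrt ?_
  have hn0 : (n : ℝ) ≠ 0 := by positivity
  calc _ ≤ (1 / (n : ℝ)) * ∑ j, (ρ j).E 0 ^ 2 + (1 / (n : ℝ)) * ∑ j, (ρ j).E 1 ^ 2 :=
        add_le_add (StarNetwork.prod_rpow_two_div_le hn fun j => (ρ j).E_nonneg 0)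
          (StarNetwork.prod_rpow_two_div_le hn fun j => (ρ j).E_nonneg 1)
    _ = (1 / (n : ℝ)) * ∑ j, ((ρ j).E 0 ^ 2 + (ρ j).E 1 ^ 2) := by
        rw [Finset.sum_add_distrib, mul_add]
    _ ≤ (1 / (n : ℝ)) * ∑ j, (1 + (ρ j).concurrence ^ 2) := by
        exact mul_le_mul_of_nonneg_left
          (Finset.sum_le_sum fun j _ => (ρ j).E_zero_sq_add_E_one_sq_le) (by positivity)
    _ = _ := by
        rw [Finset.sum_add_distrib, mul_add]
        simp [hn0]
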